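/- There is an absolute constant $c>0$ with the following property. Let $n\ge 4$, let $\xi_1,\dots,\xi_m\in\mathbb C$ be pairwise distinct, let $n_1,\dots,n_m\ge 1$ be integers with $n_1+\dots+n_m=n$, and let $$\rho_n(z)=\sum_{j=1}^m\frac{n_j}{z-\xi_j}$$ be the corresponding simple partial fraction of order $n$, i.e. the logarithmic derivative of the polynomial $\prod_{j=1}^m(z-\xi_j)^{n_j}$. Then for every non-real pole $\xi_k$ $$|\operatorname{Im}\xi_k|\cdot\|\rho_n\|_{L^\infty(\mathbb R)}\;\ge\; c\,\frac{(\ln n)^{1/n_k}+1}{(\ln n)^{1/n_k}-1}\cdot\frac{\ln\ln n}{\ln n}\;>\;2c\,\frac{n_k}{\ln n},$$ where $\|\rho_n\|_{L^\infty(\mathbb R)}\in[0,\infty]$ is the essential supremum of $|\rho_n|$ on the real line ($\infty$ if $\rho_n$ is unbounded there). -/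

import Mathlib

open MeasureTheory

/-- The simple partial fraction with poles `ξ k` and residues `ν k`, that is
`z ↦ ∑ k, ν k / (z - ξ k)`. -/
noncomputable def simplePartialFraction {m : ℕ} (ξ : Fin m → ℂ) (ν : Fin m → ℕ) (z : ℂ) : ℂ :=
  ∑ k, (ν k : ℂ) / (z - ξ k)

/-- Off its poles the simple partial fraction is the logarithmic derivative of the polynomial
`∏ k, (z - ξ k) ^ ν k`. -/
theorem simplePartialFraction_eq_logDeriv {m : ℕ} (ξ : Fin m → ℂ) (ν : Fin m → ℕ) (z : ℂ)
    (hz : ∀ k, z ≠ ξ k) :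
    simplePartialFraction ξ ν z = logDeriv (fun w : ℂ => ∏ k, (w - ξ k) ^ ν k) z := by
  rw [logDeriv_prod]
  · refine Finset.sum_congr rfl fun k _ => ?_
    rw [logDeriv_fun_pow (by fun_prop)]
    simp [logDeriv_apply, div_eq_mul_inv]
  · exact fun k _ => pow_ne_zero _ (sub_ne_zero.2 (hz k))
  · intro k _
    fun_prop

/-- The norm in `L^∞(ℝ)` of the restriction to the real line of a function on the complex plane,
as an extended nonnegative real: `∞` if the restriction is not essentially bounded. -/
noncomputable def supNormReal (f : ℂ → ℂ) : ENNReal :=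
  eLpNorm (fun x : ℝ => f (x : ℂ)) ⊤ volume

/-! Since `q * log (log n) ≤ log (log n) + 2 * ν k` for the ratio `q` in the statement
(`Real.rpow_ratio_mul_log_le`), it suffices to bound `ν k` and `log (log n)` separately by a
constant times `η * log n`, where `|ρ| ≤ 1` on the real line and `ξ k` has height `η > 0`.

Reflecting all poles into the lower half-plane keeps `Re ρ` on the real line, so the new `exp (± ρ)`
are bounded by `e` in the upper half-plane. Cauchy's estimate gives `|ρ'| ≤ 8 / Im z`, and
integrating down from a great height shows that `-Im ρ` grows only logarithmically
(`neg_im_simplePartialFraction_le`). At `ξ k` the reflected pole alone contributes `ν k / (2 * η)`,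
which bounds `ν k`.

For `log (log n)`, the same growth bound controls the polynomial `P` with the original zeros,
because reflection only increases its modulus above the real line (`norm_prod_sub_pow_le`). Near `0`
on the line, `P / P 0` is close to `1` by Gronwall, yet it vanishes at `i * η`. A two-constants
argument in a square of side about `1 / √(log n)` (`neg_log_le_of_apply_eq_zero`) makes this
impossible for small `η`. -/

/-! ### Analytic preliminaries and the elementary inequalities for the ratio. -/

/-- Maximum modulus principle on a closed rectangle. -/
theorem norm_le_of_norm_le_rectangle_boundary {f : ℂ → ℂ} {a b c d C : ℝ} (hab : a < b)
    (hcd : c < d)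
    (hf : ∀ z : ℂ, z.re ∈ Set.Icc a b → z.im ∈ Set.Icc c d → DifferentiableAt ℂ f z)
    (hbot : ∀ z : ℂ, z.re ∈ Set.Icc a b → z.im = c → ‖f z‖ ≤ C)
    (htop : ∀ z : ℂ, z.re ∈ Set.Icc a b → z.im = d → ‖f z‖ ≤ C)
    (hside : ∀ z : ℂ, z.re = a ∨ z.re = b → z.im ∈ Set.Icc c d → ‖f z‖ ≤ C)
    {z : ℂ} (hre : z.re ∈ Set.Icc a b) (him : z.im ∈ Set.Icc c d) : ‖f z‖ ≤ C := by
  have hcl : closure (Set.Ioo a b ×ℂ Set.Ioo c d) = Set.Icc a b ×ℂ Set.Icc c d := by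
    rw [Complex.closure_reProdIm, closure_Ioo hab.ne, closure_Ioo hcd.ne]
  refine Complex.norm_le_of_forall_mem_frontier_norm_le (U := Set.Ioo a b ×ℂ Set.Ioo c d)
    ((Metric.isBounded_Ioo a b).reProdIm (Metric.isBounded_Ioo c d)) ?_ ?_ ?_
  · apply DifferentiableOn.diffContOnCl
    rw [hcl]
    exact fun w hw => (hf w hw.1 hw.2).differentiableWithinAt
  · intro w hw
    rw [Complex.frontier_reProdIm, closure_Ioo hab.ne, closure_Ioo hcd.ne, frontier_Ioo hab,
      frontier_Ioo hcd] at hw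
    rcases hw with ⟨h1, h2 | h2⟩ | ⟨h1, h2⟩
    · exact hbot w h1 h2
    · exact htop w h1 h2
    · exact hside w h1 h2
  · rw [hcl]
    exact ⟨hre, him⟩

/-- If the logarithmic derivative of `q` has real part at most `ψ'`, then `‖q‖` grows at most like
`exp ψ`. -/
theorem norm_le_mul_exp_of_re_logDeriv_le {q u : ℝ → ℂ} {ψ ψ' : ℝ → ℝ} {Y : ℝ} (hY : 0 ≤ Y)
    (hq : ∀ t ∈ Set.Icc 0 Y, HasDerivAt q (u t * q t) t)
    (hψc : ContinuousOn ψ (Set.Icc 0 Y))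
    (hψ : ∀ t ∈ Set.Ioo 0 Y, HasDerivAt ψ (ψ' t) t)
    (hu : ∀ t ∈ Set.Ioo 0 Y, (u t).re ≤ ψ' t) :
    ‖q Y‖ ≤ ‖q 0‖ * Real.exp (ψ Y - ψ 0) := by
  -- The square is differentiable even where `q` vanishes, so no logarithm of `‖q‖` is needed.
  have hder : ∀ t ∈ Set.Ioo 0 Y, HasDerivAt (fun t => ‖q t‖ ^ 2 * Real.exp (-(2 * ψ t)))
      (2 * ‖q t‖ ^ 2 * Real.exp (-(2 * ψ t)) * ((u t).re - ψ' t)) t := by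
    intro t ht
    have h1 := (hq t (Set.Ioo_subset_Icc_self ht)).norm_sq
    have h2 : HasDerivAt (fun t => Real.exp (-(2 * ψ t)))
        (Real.exp (-(2 * ψ t)) * -(2 * ψ' t)) t := ((hψ t ht).const_mul 2).fun_neg.exp
    have : inner ℝ (q t) (u t * q t) = ‖q t‖ ^ 2 * (u t).re := by
      rw [Complex.inner, ← Complex.normSq_eq_norm_sq, mul_assoc, Complex.mul_conj]
      simp [mul_comm]
    rw [this] at h1
    exact (h1.mul h2).congr_deriv (by ring)
  have hanti : AntitoneOn (fun t => ‖q t‖ ^ 2 * Real.exp (-(2 * ψ t))) (Set.Icc 0 Y) := by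
    refine antitoneOn_of_deriv_nonpos (convex_Icc _ _) ?_ ?_ ?_
    · have : ContinuousOn q (Set.Icc 0 Y) :=
        fun t ht => (hq t ht).continuousAt.continuousWithinAt
      fun_prop
    · rw [interior_Icc]
      exact fun t ht => (hder t ht).differentiableAt.differentiableWithinAt
    · rw [interior_Icc]
      intro t ht
      rw [(hder t ht).deriv]
      exact mul_nonpos_of_nonneg_of_nonpos (by positivity) (by linarith [hu t ht])
  have h := hanti (Set.left_mem_Icc.2 hY) (Set.right_mem_Icc.2 hY) hY
  simp only at h
  have h2 : ‖q Y‖ ^ 2 ≤ (‖q 0‖ * Real.exp (ψ Y - ψ 0)) ^ 2 := by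
    have e : (‖q 0‖ * Real.exp (ψ Y - ψ 0)) ^ 2
        = (‖q 0‖ ^ 2 * Real.exp (-(2 * ψ 0))) * Real.exp (2 * ψ Y) := by
      rw [mul_pow, ← Real.exp_nat_mul, mul_assoc, ← Real.exp_add]
      congr 2
      push_cast
      ring
    rw [e]
    calc ‖q Y‖ ^ 2 = (‖q Y‖ ^ 2 * Real.exp (-(2 * ψ Y))) * Real.exp (2 * ψ Y) := by
          rw [mul_assoc, ← Real.exp_add]; simp
      _ ≤ _ := by gcongr
  exact le_of_sq_le_sq h2 (by positivity)

theorem Real.two_mul_sub_one_lt_add_one_mul_log {x : ℝ} (hx : 1 < x) :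
    2 * (x - 1) < (x + 1) * Real.log x := by
  have h := Real.lt_log_one_add_of_pos (sub_pos.2 hx)
  rw [div_lt_iff₀ (by linarith)] at h
  rw [add_sub_cancel] at h
  linarith

theorem Real.two_mul_lt_rpow_ratio_mul_log {L : ℝ} (hL : 1 < L) {k : ℝ} (hk : 0 < k) :
    2 * k < (L ^ (1 / k) + 1) / (L ^ (1 / k) - 1) * Real.log L := by
  have hM : 1 < L ^ (1 / k) := Real.one_lt_rpow hL (by positivity)
  have h := Real.two_mul_sub_one_lt_add_one_mul_log hM
  rw [Real.log_rpow (by linarith)] at h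
  rw [div_mul_eq_mul_div, lt_div_iff₀ (by linarith)]
  calc 2 * k * (L ^ (1 / k) - 1) = k * (2 * (L ^ (1 / k) - 1)) := by ring
    _ < k * ((L ^ (1 / k) + 1) * (1 / k * Real.log L)) := by gcongr
    _ = _ := by field_simp

/-- With `M = L ^ (1 / k)` the ratio is `1 + 2 / (M - 1)`, and `log L = k * log M ≤ k * (M - 1)`. -/
theorem Real.rpow_ratio_mul_log_le {L : ℝ} (hL : 1 < L) {k : ℝ} (hk : 0 < k) :
    (L ^ (1 / k) + 1) / (L ^ (1 / k) - 1) * Real.log L ≤ Real.log L + 2 * k := by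
  have hM : 1 < L ^ (1 / k) := Real.one_lt_rpow hL (by positivity)
  have h := Real.log_le_sub_one_of_pos (x := L ^ (1 / k)) (by linarith)
  rw [Real.log_rpow (by linarith), one_div, inv_mul_le_iff₀ hk, ← one_div] at h
  rw [div_mul_eq_mul_div, div_le_iff₀ (by linarith)]
  nlinarith

/-! ### General facts on simple partial fractions. -/

variable {m : ℕ}

theorem hasDerivAt_complex_mk (x t : ℝ) :
    HasDerivAt (fun t : ℝ => (⟨x, t⟩ : ℂ)) Complex.I t := by
  have := ((Complex.ofRealCLM.hasDerivAt (x := t)).mul_const Complex.I).const_add (x : ℂ)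
  simp only [Complex.ofRealCLM_apply, Complex.ofReal_one, one_mul] at this
  simpa only [Complex.mk_eq_add_mul_I] using this

theorem differentiableAt_simplePartialFraction {ω : Fin m → ℂ} {ν : Fin m → ℕ} {z : ℂ}
    (hz : ∀ k, z ≠ ω k) : DifferentiableAt ℂ (simplePartialFraction ω ν) z := by
  have : simplePartialFraction ω ν = fun z => ∑ k, (ν k : ℂ) / (z - ω k) := by
    ext z; rfl
  rw [this]
  refine DifferentiableAt.fun_sum fun k _ => ?_
  exact (differentiableAt_const _).fun_div (by fun_prop) (sub_ne_zero.2 (hz k))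

theorem tendsto_simplePartialFraction_cobounded (ω : Fin m → ℂ) (ν : Fin m → ℕ) :
    Filter.Tendsto (simplePartialFraction ω ν) (Bornology.cobounded ℂ) (nhds 0) := by
  have h : Filter.Tendsto (fun z : ℂ => ∑ k, (ν k : ℂ) * (z - ω k)⁻¹) (Bornology.cobounded ℂ)
      (nhds (∑ k, (ν k : ℂ) * 0)) := by
    refine tendsto_finsetSum _ fun k _ => Filter.Tendsto.const_mul _ ?_
    refine Filter.tendsto_inv₀_cobounded.comp ?_
    exact tendsto_sub_const_cobounded _
  simp only [mul_zero, Finset.sum_const_zero] at h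
  exact h.congr fun z => by simp only [simplePartialFraction, div_eq_mul_inv]

/-- Off its poles, the polynomial satisfies `Q' = ρ Q`. -/
theorem hasDerivAt_prod_sub_pow {ω : Fin m → ℂ} {ν : Fin m → ℕ} {z : ℂ} (hz : ∀ k, z ≠ ω k) :
    HasDerivAt (fun w : ℂ => ∏ k, (w - ω k) ^ ν k)
      (simplePartialFraction ω ν z * ∏ k, (z - ω k) ^ ν k) z := by
  have hd : DifferentiableAt ℂ (fun w : ℂ => ∏ k, (w - ω k) ^ ν k) z := by fun_prop
  rw [simplePartialFraction_eq_logDeriv ω ν z hz, logDeriv_apply, div_mul_cancel₀]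
  · exact hd.hasDerivAt
  · exact Finset.prod_ne_zero_iff.2 fun k _ => pow_ne_zero _ (sub_ne_zero.2 (hz k))

theorem norm_simplePartialFraction_le {ω : Fin m → ℂ} {ν : Fin m → ℕ} {z : ℂ} {H : ℝ}
    (hH : 0 < H) (hω : ∀ k, (ω k).im ≤ 0) (hz : H ≤ z.im) :
    ‖simplePartialFraction ω ν z‖ ≤ ((∑ k, ν k : ℕ) : ℝ) / H := by
  rw [simplePartialFraction, Nat.cast_sum, Finset.sum_div]
  refine (norm_sum_le _ _).trans (Finset.sum_le_sum fun k _ => ?_)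
  rw [norm_div, Complex.norm_natCast]
  have : H ≤ ‖z - ω k‖ := by
    refine le_trans ?_ (Complex.abs_im_le_norm _)
    rw [Complex.sub_im]
    exact le_trans (by linarith [hω k]) (le_abs_self _)
  gcongr

/-- Seen from above the poles, every term contributes nonnegatively to `-Im ρ`, so the term of the
pole directly below can be kept alone. -/
theorem div_le_neg_im_simplePartialFraction {ω : Fin m → ℂ} {ν : Fin m → ℕ} {z : ℂ}
    (hω : ∀ k, (ω k).im ≤ 0) (hz : 0 < z.im) (k : Fin m) (hk : (ω k).re = z.re) :
    (ν k : ℝ) / (z.im - (ω k).im) ≤ -(simplePartialFraction ω ν z).im := by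
  have e : -(simplePartialFraction ω ν z).im
      = ∑ j, (ν j : ℝ) * (z.im - (ω j).im) / Complex.normSq (z - ω j) := by
    rw [simplePartialFraction, Complex.im_sum, ← Finset.sum_neg_distrib]
    refine Finset.sum_congr rfl fun j _ => ?_
    simp [Complex.div_im]
  rw [e]
  have hpos : ∀ j, 0 < z.im - (ω j).im := fun j => by linarith [hω j]
  refine le_trans (le_of_eq ?_) (Finset.single_le_sum (f := fun j => (ν j : ℝ) *
    (z.im - (ω j).im) / Complex.normSq (z - ω j)) (fun j _ => ?_) (Finset.mem_univ k))
  · have := (hpos k).ne'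
    simp only [Complex.normSq_apply, Complex.sub_re, Complex.sub_im, hk, sub_self, mul_zero,
      zero_add]
    field_simp
  · have := (hpos j).le
    have := Complex.normSq_nonneg (z - ω j)
    positivity

/-! ### Growth estimates when all poles lie in the lower half-plane. -/

section LowerPoles

variable {ω : Fin m → ℂ} {ν : Fin m → ℕ}

theorem ne_of_im_neg_of_im_nonneg (hω : ∀ k, (ω k).im < 0) {z : ℂ} (hz : 0 ≤ z.im) (k : Fin m) :
    z ≠ ω k := by
  rintro rfl
  exact absurd (hω k) (not_lt.2 hz)

/-- The norm of `exp (s * ρ)` in the upper half-plane is at most `e` if `s = ± 1` and `|Re ρ| ≤ 1`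
on the real line. -/
theorem norm_exp_mul_simplePartialFraction_le (hω : ∀ k, (ω k).im < 0)
    (hre : ∀ x : ℝ, |(simplePartialFraction ω ν x).re| ≤ 1) {s : ℝ} (hs : |s| = 1) {z : ℂ}
    (hz : 0 ≤ z.im) : ‖Complex.exp (s * simplePartialFraction ω ν z)‖ ≤ Real.exp 1 := by
  have key : ∀ w, |(simplePartialFraction ω ν w).re| ≤ 1 →
      ‖Complex.exp (s * simplePartialFraction ω ν w)‖ ≤ Real.exp 1 := by
    intro w hw
    rw [Complex.norm_exp, Complex.re_ofReal_mul]
    refine Real.exp_le_exp.2 ((le_abs_self _).trans ?_)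
    rwa [abs_mul, hs, one_mul]
  have hfar : ∀ᶠ w in Bornology.cobounded ℂ, |(simplePartialFraction ω ν w).re| ≤ 1 := by
    have h := (tendsto_simplePartialFraction_cobounded ω ν).norm
    rw [norm_zero] at h
    filter_upwards [h.eventually_le_const one_pos] with w hw
    exact (Complex.abs_re_le_norm _).trans hw
  obtain ⟨R, hR⟩ := (Filter.hasBasis_cobounded_norm.eventually_iff.1 hfar)
  have hR := hR.2
  -- The rectangle contains `z`, and its top and lateral sides lie where `ρ` is already small.
  set T := |R| + ‖z‖ + 1 with hT
  have hR' : R ≤ T := by linarith [le_abs_self R, norm_nonneg z]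
  have hT0 : 0 < T := by positivity
  have hzT : ‖z‖ ≤ T := by linarith [abs_nonneg R]
  refine norm_le_of_norm_le_rectangle_boundary (a := -T) (b := T) (c := 0) (d := T)
    (f := fun z => Complex.exp (s * simplePartialFraction ω ν z)) (by linarith) hT0 ?_ ?_ ?_ ?_
    (abs_le.1 ((Complex.abs_re_le_norm z).trans hzT))
    ⟨hz, (le_abs_self _).trans ((Complex.abs_im_le_norm z).trans hzT)⟩
  · intro w _ hw
    exact ((differentiableAt_simplePartialFraction
      (ne_of_im_neg_of_im_nonneg hω hw.1)).const_mul _).cexp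
  · intro w _ hw
    have : w = (w.re : ℂ) := Complex.ext rfl (by simpa using hw)
    rw [this]
    exact key _ (hre _)
  · intro w _ hw
    refine key _ (hR (x := w) ?_)
    refine hR'.trans (le_trans ?_ (Complex.abs_im_le_norm w))
    rw [hw]
    exact le_abs_self _
  · intro w hw _
    refine key _ (hR (x := w) ?_)
    refine hR'.trans (le_trans ?_ (Complex.abs_re_le_norm w))
    rcases hw with hw | hw <;> rw [hw]
    · rw [abs_neg]; exact le_abs_self _
    · exact le_abs_self _

/-- Cauchy's estimate for `exp ρ` on the disc of radius `Im z`, which touches the real line, bounds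
`|(exp ρ)'|` by `e / Im z`. Multiplying by `|exp (-ρ)| ≤ e` isolates `ρ'`, and `e ^ 2 < 8`. -/
theorem norm_deriv_simplePartialFraction_le (hω : ∀ k, (ω k).im < 0)
    (hre : ∀ x : ℝ, |(simplePartialFraction ω ν x).re| ≤ 1) {z : ℂ} (hz : 0 < z.im) :
    ‖deriv (simplePartialFraction ω ν) z‖ ≤ 8 / z.im := by
  set f := simplePartialFraction ω ν with hf
  have hd : ∀ w : ℂ, 0 ≤ w.im → DifferentiableAt ℂ f w := fun w hw =>
    differentiableAt_simplePartialFraction (ne_of_im_neg_of_im_nonneg hω hw)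
  have hball : ∀ w ∈ Metric.closedBall z z.im, 0 ≤ w.im := by
    intro w hw
    rw [Metric.mem_closedBall, dist_eq_norm] at hw
    have := (neg_le_abs _).trans ((Complex.abs_im_le_norm (w - z)).trans hw)
    rw [Complex.sub_im] at this
    linarith
  have h1 : ‖deriv (fun w => Complex.exp (f w)) z‖ ≤ Real.exp 1 / z.im := by
    refine Complex.norm_deriv_le_of_forall_mem_sphere_norm_le hz ?_ ?_
    · apply DifferentiableOn.diffContOnCl
      rw [closure_ball _ hz.ne']
      exact fun w hw => (hd w (hball w hw)).cexp.differentiableWithinAt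
    · intro w hw
      simpa using norm_exp_mul_simplePartialFraction_le hω hre (s := 1) (by simp)
        (hball w (Metric.sphere_subset_closedBall hw))
  have h2 : ‖Complex.exp (-f z)‖ ≤ Real.exp 1 := by
    simpa using norm_exp_mul_simplePartialFraction_le hω hre (s := -1) (by simp) hz.le
  rw [(hd z hz.le).hasDerivAt.cexp.deriv] at h1
  have e : deriv f z = Complex.exp (-f z) * (Complex.exp (f z) * deriv f z) := by
    rw [← mul_assoc, ← Complex.exp_add]; simp
  have h3 : Real.exp 1 * Real.exp 1 ≤ 8 := by
    nlinarith [Real.exp_one_lt_d9, Real.exp_pos 1]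
  calc ‖deriv f z‖ ≤ Real.exp 1 * (Real.exp 1 / z.im) := by
        rw [e, norm_mul]; gcongr
    _ = (Real.exp 1 * Real.exp 1) / z.im := by ring
    _ ≤ 8 / z.im := by gcongr

/-- Logarithmic growth of `-Im ρ` towards the real line. -/
theorem neg_im_simplePartialFraction_le (hω : ∀ k, (ω k).im < 0)
    (hre : ∀ x : ℝ, |(simplePartialFraction ω ν x).re| ≤ 1) (x : ℝ) {h H : ℝ} (hh : 0 < h)
    (hH : h ≤ H) :
    -(simplePartialFraction ω ν ⟨x, h⟩).im
      ≤ ((∑ k, ν k : ℕ) : ℝ) / H + 8 * (Real.log H - Real.log h) := by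
  set f := simplePartialFraction ω ν with hf
  have hder : ∀ t : ℝ, 0 < t → HasDerivAt (fun t : ℝ => -(f ⟨x, t⟩).im + 8 * Real.log t)
      (-(deriv f ⟨x, t⟩ * Complex.I).im + 8 * t⁻¹) t := by
    intro t ht
    have hd : HasDerivAt f (deriv f ⟨x, t⟩) ⟨x, t⟩ :=
      (differentiableAt_simplePartialFraction
        (ne_of_im_neg_of_im_nonneg hω (z := ⟨x, t⟩) ht.le)).hasDerivAt
    have hc : HasDerivAt (fun t : ℝ => f ⟨x, t⟩) (deriv f ⟨x, t⟩ * Complex.I) t :=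
      HasDerivAt.comp t hd (hasDerivAt_complex_mk x t)
    have hi := (Complex.imCLM.hasFDerivAt.comp_hasDerivAt t hc).fun_neg
    exact hi.add ((Real.hasDerivAt_log ht.ne').const_mul 8)
  have hmono : MonotoneOn (fun t : ℝ => -(f ⟨x, t⟩).im + 8 * Real.log t) (Set.Icc h H) := by
    have hpos : ∀ t ∈ Set.Icc h H, 0 < t := fun t ht => hh.trans_le ht.1
    refine monotoneOn_of_deriv_nonneg (convex_Icc _ _) ?_ ?_ ?_
    · exact fun t ht => (hder t (hpos t ht)).continuousAt.continuousWithinAt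
    · exact fun t ht =>
        (hder t (hpos t (interior_subset ht))).differentiableAt.differentiableWithinAt
    · intro t ht
      have ht0 := hpos t (interior_subset ht)
      have hb := norm_deriv_simplePartialFraction_le hω hre (z := ⟨x, t⟩) ht0
      rw [(hder t ht0).deriv]
      have hi := (le_abs_self _).trans (Complex.abs_im_le_norm (deriv f ⟨x, t⟩ * Complex.I))
      rw [norm_mul, Complex.norm_I, mul_one] at hi
      have : (8 : ℝ) / t = 8 * t⁻¹ := div_eq_mul_inv _ _
      simp only [] at hb
      linarith
  have h1 := hmono (Set.left_mem_Icc.2 hH) (Set.right_mem_Icc.2 hH) hH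
  have h2 := norm_simplePartialFraction_le (ω := ω) (ν := ν) (z := ⟨x, H⟩) (hh.trans_le hH)
    (fun k => (hω k).le) le_rfl
  have h3 := (neg_le_abs _).trans (Complex.abs_im_le_norm (f ⟨x, H⟩))
  simp only at h1
  linarith

/-- Growth of the polynomial with zeros `ω` along vertical lines in the upper half-plane. -/
theorem norm_prod_sub_pow_le (hω : ∀ k, (ω k).im < 0)
    (hre : ∀ x : ℝ, |(simplePartialFraction ω ν x).re| ≤ 1) (hn : 1 ≤ ∑ k, ν k) (x : ℝ) {y : ℝ}
    (hy : 0 ≤ y) (hy1 : y ≤ 1) :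
    ‖∏ k, ((⟨x, y⟩ : ℂ) - ω k) ^ ν k‖ ≤ ‖∏ k, ((x : ℂ) - ω k) ^ ν k‖ *
      Real.exp (y * (9 + 8 * Real.log (∑ k, ν k : ℕ)) + 8) := by
  set n := ∑ k, ν k with hndef
  have hn' : (1 : ℝ) ≤ n := by exact_mod_cast hn
  have h := norm_le_mul_exp_of_re_logDeriv_le (Y := y) hy
    (q := fun t : ℝ => ∏ k, ((⟨x, t⟩ : ℂ) - ω k) ^ ν k)
    (u := fun t : ℝ => Complex.I * simplePartialFraction ω ν ⟨x, t⟩)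
    -- An antiderivative of the bound for `Re (i * ρ) = -Im ρ` with `H = n`. It stays continuous at
    -- `0`, and `-y * log y ≤ 1 - y` yields the summand `8`.
    (ψ := fun t => t * (9 + 8 * Real.log n) - 8 * (t * Real.log t))
    (ψ' := fun t => 1 + 8 * (Real.log n - Real.log t)) ?_ ?_ ?_ ?_
  · refine h.trans ?_
    have e : (⟨x, 0⟩ : ℂ) = x := rfl
    simp only [e]
    gcongr
    simp only [zero_mul, mul_zero, sub_zero]
    rcases hy.eq_or_lt with rfl | hy0
    · simp
    · have := Real.log_le_sub_one_of_pos (inv_pos.2 hy0)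
      rw [Real.log_inv] at this
      have h5 := mul_le_mul_of_nonneg_left this hy
      rw [mul_sub, mul_inv_cancel₀ hy0.ne'] at h5
      linarith
  · intro t ht
    have hd := hasDerivAt_prod_sub_pow (ν := ν)
      (ne_of_im_neg_of_im_nonneg hω (z := ⟨x, t⟩) ht.1)
    exact (HasDerivAt.comp t hd (hasDerivAt_complex_mk x t)).congr_deriv (by ring)
  · have := Real.continuous_mul_log
    fun_prop
  · intro t ht
    exact (((hasDerivAt_id t).mul_const _).fun_sub
      ((Real.hasDerivAt_mul_log ht.1.ne').const_mul 8)).congr_deriv (by ring)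
  · intro t ht
    have h6 := neg_im_simplePartialFraction_le hω hre x ht.1 (H := n)
      ((ht.2.le.trans hy1).trans hn')
    rw [div_self (by positivity)] at h6
    simpa using h6

end LowerPoles

/-! ### Reflection of the poles. -/

/-- The one of `w` and its complex conjugate that lies in the closed lower half-plane. -/
noncomputable def lowerReflection (w : ℂ) : ℂ := ⟨w.re, -|w.im|⟩

theorem re_simplePartialFraction_lowerReflection (ξ : Fin m → ℂ) (ν : Fin m → ℕ) (x : ℝ) :
    (simplePartialFraction (fun k => lowerReflection (ξ k)) ν x).re
      = (simplePartialFraction ξ ν x).re := by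
  simp only [simplePartialFraction, Complex.re_sum]
  refine Finset.sum_congr rfl fun k _ => ?_
  simp [lowerReflection, Complex.div_re, Complex.normSq_apply]

theorem norm_ofReal_sub_lowerReflection (x : ℝ) (w : ℂ) :
    ‖(x : ℂ) - lowerReflection w‖ = ‖(x : ℂ) - w‖ := by
  simp [lowerReflection, Complex.norm_def, Complex.normSq_apply]

theorem norm_sub_le_norm_sub_lowerReflection {z : ℂ} (hz : 0 ≤ z.im) (w : ℂ) :
    ‖z - w‖ ≤ ‖z - lowerReflection w‖ := by
  simp only [lowerReflection, Complex.norm_def, Complex.normSq_apply, Complex.sub_re,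
    Complex.sub_im]
  refine Real.sqrt_le_sqrt ?_
  nlinarith [abs_mul_abs_self w.im, le_abs_self w.im, neg_abs_le w.im,
    mul_nonneg hz (sub_nonneg.2 (neg_abs_le w.im)), mul_nonneg hz (abs_nonneg w.im)]

/-- A solution of `g' = u g`, `g 0 = 1` with `‖u‖ ≤ 1` stays close to `1`. -/
theorem norm_sub_one_le_exp_sub_one {g u : ℝ → ℂ} (hg : ∀ t, HasDerivAt g (u t * g t) t)
    (hu : ∀ t, ‖u t‖ ≤ 1) (h0 : g 0 = 1) {t : ℝ} (ht : 0 ≤ t) :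
    ‖g t - 1‖ ≤ Real.exp t - 1 := by
  have h := norm_le_gronwallBound_of_norm_deriv_right_le (f := fun t => g t - 1)
    (f' := fun t => u t * g t) (δ := 0) (K := 1) (ε := 1) (a := 0) (b := t) ?_ ?_ ?_ ?_ t
    (Set.right_mem_Icc.2 ht)
  · simpa [gronwallBound_of_K_ne_0] using h
  · exact fun s _ => ((hg s).continuousAt.sub continuousAt_const).continuousWithinAt
  · exact fun s _ => ((hg s).sub_const 1).hasDerivWithinAt
  · simp [h0]
  · intro s _
    rw [norm_mul, one_mul]
    calc ‖u s‖ * ‖g s‖ ≤ 1 * ‖g s‖ := by gcongr; exact hu s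
      _ = ‖(g s - 1) + 1‖ := by simp
      _ ≤ ‖g s - 1‖ + 1 := by simpa using norm_add_le (g s - 1) 1

/-! ### The two bounds under the normalisation `|ρ| ≤ 1`. -/

theorem natCast_le_mul_log_of_norm_le_one {ξ : Fin m → ℂ} {ν : Fin m → ℕ}
    (hξ : ∀ j, (ξ j).im ≠ 0) (hρ : ∀ x : ℝ, ‖simplePartialFraction ξ ν x‖ ≤ 1)
    (hn : 4 ≤ ∑ j, ν j) {k : Fin m} (hν : 1 ≤ ν k) (hk : 0 < (ξ k).im) :
    (ν k : ℝ) ≤ 64 * ((ξ k).im * Real.log (∑ j, ν j : ℕ)) := by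
  set n := ∑ j, ν j with hndef
  set η := (ξ k).im with hη
  have hn' : (4 : ℝ) ≤ n := by exact_mod_cast hn
  have hν' : (1 : ℝ) ≤ ν k := by exact_mod_cast hν
  have hω : ∀ j, (lowerReflection (ξ j)).im < 0 := fun j => neg_neg_of_pos (abs_pos.2 (hξ j))
  have hre : ∀ x : ℝ, |(simplePartialFraction (fun j => lowerReflection (ξ j)) ν x).re| ≤ 1 := by
    intro x
    rw [re_simplePartialFraction_lowerReflection]
    exact (Complex.abs_re_le_norm _).trans (hρ x)
  -- This height makes the term `n / H` equal to `1 / (4 * η)`, half of what a simple pole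
  -- contributes, so it is absorbed using `1 ≤ ν k`.
  have h1 := neg_im_simplePartialFraction_le hω hre (ξ k).re hk (H := 4 * n * η)
    (by nlinarith)
  have h2 := div_le_neg_im_simplePartialFraction (ν := ν) (z := ⟨(ξ k).re, η⟩)
    (fun j => (hω j).le) hk k rfl
  have h3 : (n : ℝ) / (4 * n * η) = 1 / (4 * η) := by field_simp
  have h4 : Real.log (4 * n * η) - Real.log η ≤ 2 * Real.log n := by
    rw [Real.log_mul (by positivity) hk.ne', Real.log_mul (by positivity) (by positivity)]
    have := Real.log_le_log (by norm_num) hn'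
    linarith
  have h5 : η - (lowerReflection (ξ k)).im = 2 * η := by
    simp only [lowerReflection, ← hη, abs_of_pos hk]; ring
  simp only [h5] at h2
  rw [h3] at h1
  have h6 : (ν k : ℝ) / (2 * η) ≤ 1 / (4 * η) + 16 * Real.log n := by linarith
  rw [div_le_iff₀ (by positivity)] at h6
  have h7 : (1 / (4 * η) + 16 * Real.log n) * (2 * η) = 1 / 2 + 32 * (η * Real.log n) := by
    field_simp; ring
  linarith

/-- The bounds on the boundary of the square `[-r, r] × [0, r]` and the maximum modulus principle
show that a zero of `F` near the centre of the bottom side has imaginary part at least of order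
`log (1 / ε)`, if `F` is `ε`-close to `1` on the bottom side. -/
theorem neg_log_le_of_apply_eq_zero {F : ℂ → ℂ} (hF : Differentiable ℂ F) {r ε K D y : ℝ}
    (hr : 0 < r) (hε : 0 < ε) (hD : Real.log ε ≤ D)
    (hbot : ∀ x : ℝ, |x| ≤ r → ‖F x - 1‖ ≤ ε)
    (hbox : ∀ z : ℂ, |z.re| ≤ r → 0 ≤ z.im → z.im ≤ r →
      ‖F z - 1‖ ≤ Real.exp (K * z.im + D))
    (hy : 0 ≤ y) (hyr : y ≤ r / 4) (h0 : F ⟨0, y⟩ = 0) :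
    -Real.log ε ≤ 2 * K * y + D := by
  -- The harmonic function `x² - y² + 2ry`, the real part of `z² - 2irz`, is at least `r²` on the
  -- top and lateral sides, nonnegative on the bottom, and at most `r² / 2` at `i * y` for `y ≤ r /
  -- 4`. So `E` brings the bound on all sides down to `ε` at little cost at the zero.
  set E : ℂ → ℂ := fun z => Complex.exp (Complex.I * K * z -
    ((D - Real.log ε) / r ^ 2 : ℝ) * (z ^ 2 - 2 * Complex.I * r * z)) with hE
  have hEn : ∀ z, ‖E z‖ = Real.exp (-(K * z.im) -
      (D - Real.log ε) / r ^ 2 * (z.re ^ 2 - z.im ^ 2 + 2 * r * z.im)) := by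
    intro z
    rw [hE, Complex.norm_exp]
    congr 1
    rw [Complex.sub_re, Complex.re_ofReal_mul]
    simp [pow_two]
  have hbd : ∀ z : ℂ, |z.re| ≤ r → 0 ≤ z.im → z.im ≤ r →
      r ^ 2 ≤ z.re ^ 2 - z.im ^ 2 + 2 * r * z.im → ‖(F z - 1) * E z‖ ≤ ε := by
    intro z h1 h2 h3 h4
    rw [norm_mul, hEn]
    calc _ ≤ Real.exp (K * z.im + D) * Real.exp (-(K * z.im) -
          (D - Real.log ε) / r ^ 2 * (z.re ^ 2 - z.im ^ 2 + 2 * r * z.im)) := by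
          gcongr; exact hbox z h1 h2 h3
      _ ≤ Real.exp (K * z.im + D) * Real.exp (-(K * z.im) -
          (D - Real.log ε) / r ^ 2 * r ^ 2) := by
          have : 0 ≤ D - Real.log ε := sub_nonneg.2 hD
          gcongr
      _ = ε := by
          rw [← Real.exp_add, div_mul_cancel₀ _ (by positivity)]
          ring_nf
          exact Real.exp_log hε
  have hmax := norm_le_of_norm_le_rectangle_boundary (a := -r) (b := r) (c := 0) (d := r)
    (C := ε) (f := fun z => (F z - 1) * E z) (by linarith) hr ?_ ?_ ?_ ?_ (z := ⟨0, y⟩)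
    ⟨by simpa using hr.le, hr.le⟩ ⟨hy, by simp only; linarith⟩
  · simp only [h0, zero_sub, norm_mul, norm_neg, norm_one, one_mul, hEn] at hmax
    rw [← Real.le_log_iff_exp_le hε] at hmax
    have h1 : (D - Real.log ε) / r ^ 2 * ((0 : ℝ) ^ 2 - y ^ 2 + 2 * r * y)
        ≤ (D - Real.log ε) / r ^ 2 * (r ^ 2 / 2) := by
      have : 0 ≤ D - Real.log ε := sub_nonneg.2 hD
      gcongr
      nlinarith
    have h2 : (D - Real.log ε) / r ^ 2 * (r ^ 2 / 2) = (D - Real.log ε) / 2 := by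
      field_simp
    linarith
  · intro z _ _
    have := hF z
    simp only [hE]
    fun_prop
  · intro z hz hz0
    have e : z = (z.re : ℂ) := Complex.ext rfl (by simpa using hz0)
    rw [norm_mul, hEn, hz0]
    calc _ ≤ ε * 1 := by
          gcongr
          · rw [e]; exact hbot _ (abs_le.2 hz)
          · rw [Real.exp_le_one_iff]
            have : 0 ≤ D - Real.log ε := sub_nonneg.2 hD
            have : 0 ≤ (D - Real.log ε) / r ^ 2 * z.re ^ 2 := by positivity
            simpa using this
      _ = ε := mul_one _
  · intro z hz hz0
    refine hbd z (abs_le.2 hz) (hz0 ▸ hr.le) hz0.le ?_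
    rw [hz0]
    nlinarith [sq_nonneg z.re]
  · intro z hz hz0
    have h1 : |z.re| = r := by
      rcases hz with h | h <;> rw [h]
      · rw [abs_neg, abs_of_pos hr]
      · rw [abs_of_pos hr]
    refine hbd z h1.le hz0.1 hz0.2 ?_
    have : z.re ^ 2 = r ^ 2 := by rw [← sq_abs, h1]
    nlinarith [hz0.1, hz0.2]

theorem log_log_le_mul_log_of_norm_le_one {ξ : Fin m → ℂ} {ν : Fin m → ℕ}
    (hξ : ∀ j, (ξ j).im ≠ 0) (hρ : ∀ x : ℝ, ‖simplePartialFraction ξ ν x‖ ≤ 1)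
    (hn : 4 ≤ ∑ j, ν j) {k : Fin m} (hν : 1 ≤ ν k) (hk : 0 < (ξ k).im) (hk0 : (ξ k).re = 0) :
    Real.log (Real.log (∑ j, ν j : ℕ)) ≤ 1600 * ((ξ k).im * Real.log (∑ j, ν j : ℕ)) := by
  have hlow := natCast_le_mul_log_of_norm_le_one hξ hρ hn hν hk
  have hν' : (1 : ℝ) ≤ ν k := by exact_mod_cast hν
  have hlow := hν'.trans hlow
  set n := ∑ j, ν j with hndef
  set η := (ξ k).im with hη
  have hn' : (4 : ℝ) ≤ n := by exact_mod_cast hn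
  set L := Real.log n with hL
  have hL1 : 1.386 ≤ L := by
    have h := Real.log_le_log (by norm_num) hn'
    rw [show (4 : ℝ) = 2 ^ 2 by norm_num, Real.log_pow] at h
    have := Real.log_two_gt_d9
    push_cast at h
    linarith
  have hs0 : 0 < √L := Real.sqrt_pos.2 (by linarith)
  have hsq : √L * √L = L := Real.mul_self_sqrt (by linarith)
  have hX : Real.log L = 2 * Real.log √L := by rw [Real.log_sqrt (by linarith)]; ring
  have hr1 : (√L)⁻¹ ≤ 1 := inv_le_one_of_one_le₀ (Real.one_le_sqrt.2 (by linarith))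
  -- With this side, `-log (2 * r)` is `log L / 2` up to a constant.
  set r := (√L)⁻¹ with hr
  have hr0 : 0 < r := inv_pos.2 hs0
  -- For `η ≥ r / 4` the claim is direct: `log L = 2 * log √L` is at most `2 * √L ≤ 8 * η * L`.
  rcases le_total (r / 4) η with hcase | hcase
  · have h1 := Real.log_le_sub_one_of_pos hs0
    have h2 : √L ≤ 4 * (η * L) := by
      have : r * L = √L := by
        calc r * L = (√L)⁻¹ * (√L * √L) := by rw [hsq]
          _ = √L := by field_simp
      nlinarith
    linarith
  have hω : ∀ j, (lowerReflection (ξ j)).im < 0 := fun j => neg_neg_of_pos (abs_pos.2 (hξ j))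
  have hre : ∀ x : ℝ, |(simplePartialFraction (fun j => lowerReflection (ξ j)) ν x).re| ≤ 1 := by
    intro x
    rw [re_simplePartialFraction_lowerReflection]
    exact (Complex.abs_re_le_norm _).trans (hρ x)
  set P : ℂ → ℂ := fun z => ∏ j, (z - ξ j) ^ ν j with hP
  have hPd : Differentiable ℂ P := by intro z; simp only [hP]; fun_prop
  have hreal : ∀ (x : ℝ) (j : Fin m), (x : ℂ) ≠ ξ j := by
    intro x j h
    exact hξ j (by rw [← h]; simp)
  have hP0 : P 0 ≠ 0 := Finset.prod_ne_zero_iff.2 fun j _ =>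
    pow_ne_zero _ (sub_ne_zero.2 (by simpa using hreal 0 j))
  have hline : ∀ x : ℝ, ‖P x / P 0 - 1‖ ≤ Real.exp |x| - 1 := by
    have key : ∀ s : ℝ, |s| = 1 → ∀ t : ℝ, 0 ≤ t →
        ‖P ((s * t : ℝ) : ℂ) / P 0 - 1‖ ≤ Real.exp t - 1 := by
      intro s hs t ht
      refine norm_sub_one_le_exp_sub_one (g := fun t : ℝ => P ((s * t : ℝ) : ℂ) / P 0)
        (u := fun t => s * simplePartialFraction ξ ν ((s * t : ℝ) : ℂ)) ?_ ?_ ?_ ht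
      · intro t
        have h1 := hasDerivAt_prod_sub_pow (ν := ν) (hreal (s * t))
        have h2 : HasDerivAt (fun t : ℝ => ((s * t : ℝ) : ℂ)) (s : ℂ) t := by
          simpa using ((hasDerivAt_id t).const_mul s).ofReal_comp
        refine ((HasDerivAt.comp t h1 h2).div_const (P 0)).congr_deriv ?_
        simp only [hP]
        ring
      · intro t
        rw [norm_mul, Complex.norm_real, Real.norm_eq_abs, hs, one_mul]
        exact hρ _
      · simp [hP0]
    intro x
    rcases le_total 0 x with hx | hx
    · simpa [abs_of_nonneg hx] using key 1 (by simp) x hx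
    · simpa [abs_of_nonpos hx] using key (-1) (by simp) (-x) (by linarith)
  have hlogr : Real.log (2 * r) = Real.log 2 - Real.log L / 2 := by
    rw [Real.log_mul (by norm_num) hr0.ne', hr, Real.log_inv, hX]; ring
  have hX0 : 0 < Real.log L := Real.log_pos (by linarith)
  have hlog2 := Real.log_two_lt_d9
  have h := neg_log_le_of_apply_eq_zero (F := fun z => P z / P 0) (hPd.div_const _) (r := r)
    (ε := 2 * r) (K := 9 + 8 * L) (D := 10) (y := η) hr0 (by positivity) (by linarith)
    ?_ ?_ hk.le hcase ?_
  · rw [hlogr] at h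
    -- The additive constants are absorbed by `hlow`, which says `1 ≤ 64 * η * L`.
    have : η * 1.386 ≤ η * L := by gcongr
    linarith
  · intro x hx
    refine (hline x).trans ?_
    have h1 := Real.abs_exp_sub_one_le (x := |x|) (by rw [abs_abs]; linarith)
    rw [abs_abs] at h1
    linarith [le_abs_self (Real.exp |x| - 1)]
  · intro z hz1 hz2 hz3
    have h1 : ‖P z‖ ≤ ‖∏ j, (z - lowerReflection (ξ j)) ^ ν j‖ := by
      simp only [hP, norm_prod, norm_pow]
      gcongr
      exact norm_sub_le_norm_sub_lowerReflection hz2 _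
    have h2 : ‖∏ j, ((z.re : ℂ) - lowerReflection (ξ j)) ^ ν j‖ = ‖P z.re‖ := by
      simp only [hP, norm_prod, norm_pow, norm_ofReal_sub_lowerReflection]
    have h3 := norm_prod_sub_pow_le (ν := ν) hω hre (by omega) z.re hz2 (hz3.trans hr1)
    rw [h2] at h3
    have h4 : ‖P z.re / P 0‖ ≤ Real.exp 1 := by
      have h5 := norm_add_le (P z.re / P 0 - 1) 1
      rw [sub_add_cancel, norm_one] at h5
      have h6 : Real.exp |z.re| ≤ Real.exp 1 := Real.exp_le_exp.2 (hz1.trans hr1)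
      linarith [hline z.re]
    have h7 : ‖P z / P 0‖ ≤ Real.exp ((9 + 8 * L) * z.im + 9) := by
      rw [norm_div] at h4 ⊢
      calc ‖P z‖ / ‖P 0‖ ≤ ‖P z.re‖ * Real.exp (z.im * (9 + 8 * L) + 8) / ‖P 0‖ := by
            gcongr
            exact h1.trans h3
        _ = ‖P z.re‖ / ‖P 0‖ * Real.exp (z.im * (9 + 8 * L) + 8) := by ring
        _ ≤ Real.exp 1 * Real.exp (z.im * (9 + 8 * L) + 8) := by gcongr
        _ = _ := by rw [← Real.exp_add]; ring_nf
    have h8 : 0 ≤ (9 + 8 * L) * z.im + 9 := by positivity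
    have h9 := norm_sub_le (P z / P 0) 1
    rw [norm_one] at h9
    have h10 : Real.exp ((9 + 8 * L) * z.im + 10)
        = Real.exp 1 * Real.exp ((9 + 8 * L) * z.im + 9) := by
      rw [← Real.exp_add]; ring_nf
    have h11 := Real.one_le_exp h8
    have h12 := Real.add_one_le_exp (1 : ℝ)
    rw [h10]
    nlinarith
  · have : (⟨0, η⟩ : ℂ) = ξ k := Complex.ext hk0.symm rfl
    simp only [this, hP]
    rw [Finset.prod_eq_zero (Finset.mem_univ k) (by simp; omega), zero_div]

/-! ### Normalisation. -/

/-- Affine change of variables that normalises the bound on the real line to `1` and moves the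
pole `ξ k` to the positive imaginary axis. -/
theorem log_log_add_le_mul_log {ξ : Fin m → ℂ} {ν : Fin m → ℕ} (hξ : ∀ j, (ξ j).im ≠ 0) {A : ℝ}
    (hA : 0 < A) (hρ : ∀ x : ℝ, ‖simplePartialFraction ξ ν x‖ ≤ A) (hn : 4 ≤ ∑ j, ν j)
    {k : Fin m} (hν : 1 ≤ ν k) :
    Real.log (Real.log (∑ j, ν j : ℕ)) + 2 * ν k
      ≤ 2000 * (|(ξ k).im| * A * Real.log (∑ j, ν j : ℕ)) := by
  obtain ⟨s, hs, hsk⟩ : ∃ s : ℝ, (s = 1 ∨ s = -1) ∧ s * (ξ k).im = |(ξ k).im| := by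
    rcases abs_choice (ξ k).im with h | h
    · exact ⟨1, .inl rfl, by rw [h, one_mul]⟩
    · exact ⟨-1, .inr rfl, by rw [h]; ring⟩
  -- If `ξ k` lies below the real line, `s = -1` conjugates all poles, which conjugates `ρ` on the
  -- line.
  set ζ : Fin m → ℂ := fun j => ⟨A * ((ξ j).re - (ξ k).re), A * (s * (ξ j).im)⟩ with hζ
  have hs0 : s ≠ 0 := by rcases hs with rfl | rfl <;> norm_num
  have hζim : ∀ j, (ζ j).im ≠ 0 := fun j => mul_ne_zero hA.ne' (mul_ne_zero hs0 (hξ j))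
  have hζk : (ζ k).im = |(ξ k).im| * A := by simp only [hζ, hsk]; ring
  have hbound : ∀ x : ℝ, ‖simplePartialFraction ζ ν x‖ ≤ 1 := by
    intro x
    set t : ℝ := x / A + (ξ k).re with ht
    have hx : x = A * (t - (ξ k).re) := by rw [ht]; field_simp; ring
    have h := hρ t
    rcases hs with rfl | rfl
    · have e : simplePartialFraction ζ ν x = (A : ℂ)⁻¹ * simplePartialFraction ξ ν t := by
        simp only [simplePartialFraction, Finset.mul_sum]
        refine Finset.sum_congr rfl fun j _ => ?_
        have : (x : ℂ) - ζ j = A * (t - ξ j) := by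
          rw [hx]; apply Complex.ext <;> simp [hζ]; ring
        rw [this, mul_comm (A : ℂ), ← div_div, div_eq_inv_mul _ (A : ℂ)]
      rw [e, norm_mul, norm_inv, Complex.norm_real, Real.norm_of_nonneg hA.le,
        inv_mul_le_iff₀ hA, mul_one]
      exact h
    · have e : simplePartialFraction ζ ν x
          = (A : ℂ)⁻¹ * (starRingEnd ℂ) (simplePartialFraction ξ ν t) := by
        simp only [simplePartialFraction, Finset.mul_sum, map_sum]
        refine Finset.sum_congr rfl fun j _ => ?_
        have : (x : ℂ) - ζ j = A * (starRingEnd ℂ) (t - ξ j) := by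
          rw [hx]; apply Complex.ext <;> simp [hζ]; ring
        rw [this, mul_comm (A : ℂ), ← div_div, div_eq_inv_mul _ (A : ℂ), map_div₀,
          Complex.conj_natCast]
      rw [e, norm_mul, norm_inv, Complex.norm_real, Real.norm_of_nonneg hA.le, RCLike.norm_conj,
        inv_mul_le_iff₀ hA, mul_one]
      exact h
  have hpos : 0 < (ζ k).im := by
    rw [hζk]; exact mul_pos (abs_pos.2 (hξ k)) hA
  have h1 := natCast_le_mul_log_of_norm_le_one hζim hbound hn hν hpos
  have h2 := log_log_le_mul_log_of_norm_le_one hζim hbound hn hν hpos (by simp [hζ])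
  rw [hζk] at h1 h2
  have h3 : 0 ≤ Real.log (∑ j, ν j : ℕ) := Real.log_natCast_nonneg _
  have h4 : 0 ≤ |(ξ k).im| * A * Real.log (∑ j, ν j : ℕ) := by positivity
  linarith

/-! ### From the essential supremum to pointwise bounds. -/

/-- An essential bound on the real line holds at all points that are not poles. -/
theorem norm_simplePartialFraction_le_of_supNormReal_ne_top {ξ : Fin m → ℂ} {ν : Fin m → ℕ}
    (h : supNormReal (simplePartialFraction ξ ν) ≠ ⊤) {x : ℝ} (hx : ∀ j, (x : ℂ) ≠ ξ j) :
    ‖simplePartialFraction ξ ν x‖ ≤ (supNormReal (simplePartialFraction ξ ν)).toReal := by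
  set A := (supNormReal (simplePartialFraction ξ ν)).toReal with hA
  have hae : ∀ᵐ y : ℝ, ‖simplePartialFraction ξ ν y‖ ≤ A := by
    have h1 := ae_le_eLpNormEssSup (μ := volume)
      (f := fun y : ℝ => simplePartialFraction ξ ν (y : ℂ))
    filter_upwards [h1] with y hy
    rw [← eLpNorm_exponent_top] at hy
    have := ENNReal.toReal_mono h hy
    simpa using this
  have hdense := Measure.dense_of_ae hae
  have hcont : ContinuousAt (fun y : ℝ => ‖simplePartialFraction ξ ν y‖) x :=
    ((differentiableAt_simplePartialFraction hx).continuousAt.comp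
      Complex.continuous_ofReal.continuousAt).norm
  by_contra! hlt
  obtain ⟨y, hy1, hy2⟩ := hdense.inter_nhds_nonempty (hcont.eventually_const_lt hlt)
  exact lt_irrefl A (lt_of_lt_of_le hy2 hy1)

/-- A simple partial fraction which is essentially bounded on the real line has no real poles. -/
theorem im_ne_zero_of_supNormReal_ne_top {ξ : Fin m → ℂ} {ν : Fin m → ℕ}
    (h : supNormReal (simplePartialFraction ξ ν) ≠ ⊤) (hξ : Function.Injective ξ) {k : Fin m}
    (hν : 1 ≤ ν k) : (ξ k).im ≠ 0 := by
  intro hk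
  set a := (ξ k).re with ha
  have hak : ((a : ℝ) : ℂ) = ξ k := Complex.ext (by simp [ha]) (by simp [hk])
  set g : ℝ → ℂ := fun x => ∑ j ∈ Finset.univ.erase k, (ν j : ℂ) / (x - ξ j) with hg
  have hgc : ContinuousAt g a := by
    refine tendsto_finsetSum _ fun j hj => ?_
    have : ((a : ℝ) : ℂ) - ξ j ≠ 0 := by
      rw [hak]
      exact sub_ne_zero.2 fun e => Finset.ne_of_mem_erase hj (hξ e).symm
    have : ContinuousAt (fun x : ℝ => (ν j : ℂ) / (x - ξ j)) a := by fun_prop (disch := assumption)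
    exact this
  have hsub : Filter.Tendsto (fun x : ℝ => (x : ℂ) - a) (nhdsWithin a {a}ᶜ) (nhds 0) := by
    have : ContinuousAt (fun x : ℝ => (x : ℂ) - a) a := by fun_prop
    simpa using this.tendsto.mono_left nhdsWithin_le_nhds
  have hoff : ∀ᶠ x : ℝ in nhdsWithin a {a}ᶜ, ∀ j, (x : ℂ) ≠ ξ j := by
    rw [Filter.eventually_all]
    intro j
    by_cases hj : ξ j = a
    · filter_upwards [self_mem_nhdsWithin] with x hx
      rw [hj]
      exact_mod_cast hx
    · have : ∀ᶠ x : ℝ in nhds a, (x : ℂ) ≠ ξ j :=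
        Complex.continuous_ofReal.continuousAt.eventually_ne (Ne.symm hj)
      exact this.filter_mono nhdsWithin_le_nhds
  -- At a real pole `a`, boundedness forces `(x - a) * ρ x` to tend to `0`, whereas its limit is the
  -- residue `ν k`.
  have h1 : Filter.Tendsto (fun x : ℝ => ((x : ℂ) - a) * simplePartialFraction ξ ν x)
      (nhdsWithin a {a}ᶜ) (nhds 0) := by
    rw [tendsto_zero_iff_norm_tendsto_zero]
    have hb := (hsub.norm).mul_const (supNormReal (simplePartialFraction ξ ν)).toReal
    rw [norm_zero, zero_mul] at hb
    refine squeeze_zero' (.of_forall fun x => norm_nonneg _) ?_ hb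
    filter_upwards [hoff] with x hx
    rw [norm_mul]
    gcongr
    exact norm_simplePartialFraction_le_of_supNormReal_ne_top h hx
  have h2 : Filter.Tendsto (fun x : ℝ => ((x : ℂ) - a) * simplePartialFraction ξ ν x)
      (nhdsWithin a {a}ᶜ) (nhds (ν k + 0 * g a)) := by
    refine Filter.Tendsto.congr' ?_ ((hsub.mul
      (hgc.tendsto.mono_left nhdsWithin_le_nhds)).const_add (ν k : ℂ))
    filter_upwards [hoff] with x hx
    have hxk : (x : ℂ) - ξ k ≠ 0 := sub_ne_zero.2 (hx k)
    rw [simplePartialFraction, ← Finset.add_sum_erase _ _ (Finset.mem_univ k), mul_add, hak,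
      mul_div_cancel₀ _ hxk]
  have h3 := tendsto_nhds_unique h1 h2
  rw [zero_mul, add_zero] at h3
  have : ν k = 0 := by exact_mod_cast h3.symm
  omega

/-! ### The main theorem. -/

theorem theorem1 :
    ∃ c : ℝ, 0 < c ∧
      ∀ (n : ℕ), 4 ≤ n →
      ∀ (m : ℕ) (ξ : Fin m → ℂ) (ν : Fin m → ℕ),
        Function.Injective ξ → (∀ j, 1 ≤ ν j) → ∑ j, ν j = n →
      ∀ k : Fin m, (ξ k).im ≠ 0 →
        ENNReal.ofReal
            (c * ((Real.log n ^ (1 / (ν k : ℝ)) + 1) / (Real.log n ^ (1 / (ν k : ℝ)) - 1)) *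
              (Real.log (Real.log n) / Real.log n))
          ≤ ENNReal.ofReal |(ξ k).im| * supNormReal (simplePartialFraction ξ ν) ∧
        2 * c * ((ν k : ℝ) / Real.log n) <
          c * ((Real.log n ^ (1 / (ν k : ℝ)) + 1) / (Real.log n ^ (1 / (ν k : ℝ)) - 1)) *
            (Real.log (Real.log n) / Real.log n) := by
  refine ⟨1 / 2000, by norm_num, ?_⟩
  rintro n hn m ξ ν hξ hν rfl k hk
  set n := ∑ j, ν j with hndef
  have hn' : (4 : ℝ) ≤ n := by exact_mod_cast hn
  have hνk : (0 : ℝ) < ν k := by exact_mod_cast hν k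
  have hL : 1 < Real.log n := by
    rw [Real.lt_log_iff_exp_lt (by positivity)]
    linarith [Real.exp_one_lt_d9]
  have hL0 : 0 < Real.log n := one_pos.trans hL
  set q := (Real.log n ^ (1 / (ν k : ℝ)) + 1) / (Real.log n ^ (1 / (ν k : ℝ)) - 1) with hq
  have hq1 : 2 * ν k < q * Real.log (Real.log n) := Real.two_mul_lt_rpow_ratio_mul_log hL hνk
  have hq2 : q * Real.log (Real.log n) ≤ Real.log (Real.log n) + 2 * ν k :=
    Real.rpow_ratio_mul_log_le hL hνk
  refine ⟨?_, ?_⟩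
  · have hy : 0 < |(ξ k).im| := abs_pos.2 hk
    by_cases htop : supNormReal (simplePartialFraction ξ ν) = ⊤
    · rw [htop, ENNReal.mul_top (by simpa using hk)]
      exact le_top
    have him : ∀ j, (ξ j).im ≠ 0 := fun j => im_ne_zero_of_supNormReal_ne_top htop hξ (hν j)
    rw [← ENNReal.ofReal_toReal htop, ← ENNReal.ofReal_mul hy.le]
    refine ENNReal.ofReal_le_ofReal ?_
    set A := (supNormReal (simplePartialFraction ξ ν)).toReal with hA
    have hA0 : 0 ≤ A := ENNReal.toReal_nonneg
    have hbound : ∀ x : ℝ, ‖simplePartialFraction ξ ν x‖ ≤ A := fun x =>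
      norm_simplePartialFraction_le_of_supNormReal_ne_top htop fun j hj =>
        him j (by rw [← hj]; simp)
    -- The rescaling needs a positive bound, so `A`, not known to be nonzero, is enlarged slightly.
    refine le_of_forall_pos_le_add fun ε hε => ?_
    have h := log_log_add_le_mul_log him (A := A + ε / |(ξ k).im|) (by positivity)
      (fun x => (hbound x).trans (le_add_of_nonneg_right (by positivity))) hn (hν k)
    rw [mul_add, mul_div_cancel₀ _ hy.ne'] at h
    rw [← mul_div_assoc, div_le_iff₀ hL0]
    linarith
  · rw [← mul_div_assoc, ← mul_div_assoc (1 / 2000 * q), div_lt_div_iff_of_pos_right hL0]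
    linarith
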